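/- Setting. Let $U\subset\mathbb R^3$ be open, connected and non-empty. A smooth map $f:U\to\mathbb R^3$ is a triply orthogonal system if $\partial_1f,\partial_2f,\partial_3f$ are pairwise orthogonal and $\det(\partial_1f,\partial_2f,\partial_3f)\neq0$ on $U$. For $(i,j,k)$ a cyclic permutation of $(1,2,3)$ let $N_i=\partial_jf\times\partial_kf/|\partial_jf\times\partial_kf|$ be the unit normals, define the Lamé coefficients $H_i$ by $\partial_if=H_iN_i$, and put $\beta_{ij}=\frac1{H_i}\partial_iH_j$ for $i\neq j$. For $\chi:U\to\mathbb R$, $f$ is a $\chi$-system if $H_1^2+H_2^2-H_3^2=\chi$, and a Guichard net if it is a $0$-system. A triply orthogonal system $\bar f$ on $U$ is a Combescure transform of $f$ if $\partial_i\bar f$ is parallel to $\partial_if$ for $i=1,2,3$; its Lamé coefficients $\bar H_i$ are then taken with respect to the common normals: $\partial_i\bar f=\bar H_iN_i$. For nowhere vanishing $\bar f$, the Ribaucour transforms of $f$ induced by $\bar f$ are the maps $$f'=f-\frac{2\varphi}{\gamma_1^2+\gamma_2^2+\gamma_3^2}(\gamma_1N_1+\gamma_2N_2+\gamma_3N_3),$$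 where $\gamma_i=\bar f\cdot N_i$ (these functions satisfy $\partial_i\gamma_j=\beta_{ji}\gamma_i$ for $i\ne j$) and $\varphi$ is any smooth solution of $\partial_i\varphi=H_i\gamma_i$, $i=1,2,3$. Such an $f'$ may degenerate, i.e. some $\partial_if'$ may vanish at some points. Theorem. Let $f$ be a Guichard net on $U$, let $\alpha\neq0$ be a real number, and let $\bar f$ be a Combescure transform of $f$ that is an $\alpha^2|\bar f|^2$-system and vanishes nowhere on $U$. Put $$\varphi=\frac1{\alpha^2}\bigl(H_1\bar H_1+H_2\bar H_2-H_3\bar H_3\bigr),\qquad \mathcal R(f)=f-\frac{2\varphi}{|\bar f|^2}\bar f,\qquad \mathcal R(H_i)=H_i-\frac{2\varphi}{|\bar f|^2}\bar H_i .$$ Then: 1. The Ribaucour transforms of $f$ induced by $\bar f$ are exactly the maps $f-\frac{2(\varphi+c)}{|\bar f|^2}\bar f$, $c\in\mathbb R$; in particular $\mathcal R(f)$ is one of them. 2. There are smooth vector fields $N_1',N_2',N_3'$ on $U$, orthonormal at every point, with $\partial_i\mathcal R(f)=\mathcal R(H_i)N_i'$ for $i=1,2,3$. 3. $\mathcal R(f)$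 is the only Guichard net among these transforms: if $g$ is one of them and $V\subseteq U$ is a non-empty connected open set on which $g$ is a triply orthogonal system, then $g|_V$ is a Guichard net if and only if $g=\mathcal R(f)$ on $U$. Moreover, also without assuming that $g$ is non-degenerate, for every non-empty open $V\subseteq U$ the condition $|\partial_1g|^2+|\partial_2g|^2-|\partial_3g|^2=0$ holds on $V$ if and only if $g=\mathcal R(f)$ on $U$. -/

import Mathlib

open scoped ContDiff

/-- Euclidean three-space. -/
abbrev E3 : Type := EuclideanSpace ℝ (Fin 3)

namespace TriplyOrthogonal

noncomputable section

/-- The partial derivative `∂ᵢ g` at `x`. The indices `0, 1, 2` stand for the variables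
`x₁, x₂, x₃`. -/
def pd {F : Type*} [NormedAddCommGroup F] [NormedSpace ℝ F]
    (i : Fin 3) (g : E3 → F) (x : E3) : F :=
  fderiv ℝ g x (EuclideanSpace.single i 1)

/-- The cross product on Euclidean three-space. -/
def cross (v w : E3) : E3 :=
  WithLp.toLp 2 (crossProduct (WithLp.ofLp v) (WithLp.ofLp w))

/-- A triply orthogonal system on the domain `U`: a smooth map with pairwise orthogonal partial
derivatives and nowhere vanishing Jacobian determinant. -/
structure IsTriplyOrthogonalSystem (U : Set E3) (f : E3 → E3) : Prop where
  isOpen : IsOpen U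
  isConnected : IsConnected U
  smooth : ContDiffOn ℝ ∞ f U
  orthogonal : ∀ x ∈ U, ∀ i j, i ≠ j → inner ℝ (pd i f x) (pd j f x) = 0
  det_ne_zero : ∀ x ∈ U, (Matrix.of fun i j => pd j f x i).det ≠ 0

/-- The unit normal `Nᵢ = (∂ⱼf × ∂ₖf) / |∂ⱼf × ∂ₖf|` of the coordinate surface `xᵢ = const`, where
`(i, j, k)` is a cyclic permutation of the indices. -/
def unitNormal (f : E3 → E3) (i : Fin 3) (x : E3) : E3 :=
  ‖cross (pd (i + 1) f x) (pd (i + 2) f x)‖⁻¹ • cross (pd (i + 1) f x) (pd (i + 2) f x)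

/-- The coefficient of `∂ᵢ g` along the unit normal `Nᵢ` of `f`. If `g` is a Combescure transform
of `f`, then `∂ᵢ g = (lameAlong f g i) Nᵢ`: these are the Lamé coefficients of `g`
with respect to the unit normals that `f` and `g` have in common. -/
def lameAlong (f g : E3 → E3) (i : Fin 3) (x : E3) : ℝ :=
  inner ℝ (pd i g x) (unitNormal f i x)

/-- The Lamé coefficients `Hᵢ` of `f`, determined by `∂ᵢ f = Hᵢ Nᵢ`. -/
def lame (f : E3 → E3) (i : Fin 3) (x : E3) : ℝ :=
  lameAlong f f i x

/-- The rotational coefficients `βᵢⱼ = (1 / Hᵢ) ∂ᵢ Hⱼ`. -/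
def rotCoeff (f : E3 → E3) (i j : Fin 3) (x : E3) : ℝ :=
  (lame f i x)⁻¹ * pd i (lame f j) x

/-- A `χ`-system: a triply orthogonal system with `H₁² + H₂² - H₃² = χ`. -/
def IsChiSystem (U : Set E3) (f : E3 → E3) (χ : E3 → ℝ) : Prop :=
  IsTriplyOrthogonalSystem U f ∧
    ∀ x ∈ U, lame f 0 x ^ 2 + lame f 1 x ^ 2 - lame f 2 x ^ 2 = χ x

/-- A Guichard net is a `0`-system. -/
def IsGuichardNet (U : Set E3) (f : E3 → E3) : Prop :=
  IsChiSystem U f (fun _ => 0)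

/-- Two triply orthogonal systems are related by a Combescure transformation if corresponding
coordinate surfaces are, that is, if on each surface `xₖ = const` the corresponding coordinate
lines have parallel tangent directions. -/
def IsCombescurePair (U : Set E3) (f g : E3 → E3) : Prop :=
  IsTriplyOrthogonalSystem U f ∧ IsTriplyOrthogonalSystem U g ∧
    ∀ k i : Fin 3, i ≠ k → ∃ h : E3 → ℝ, ∀ x ∈ U, pd i g x = h x • pd i f x

/-- The functions `γ₁, γ₂, γ₃, φ` satisfy the system describing a Ribaucour transformation of
`f`. -/
structure IsRibaucourData (U : Set E3) (f : E3 → E3) (γ : Fin 3 → E3 → ℝ) (φ : E3 → ℝ) :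
    Prop where
  smooth_gamma : ∀ i, ContDiffOn ℝ ∞ (γ i) U
  smooth_phi : ContDiffOn ℝ ∞ φ U
  pd_gamma : ∀ x ∈ U, ∀ i j, i ≠ j → pd i (γ j) x = rotCoeff f j i x * γ i x
  pd_phi : ∀ x ∈ U, ∀ i, pd i φ x = lame f i x * γ i x
  gamma_ne_zero : ∀ x ∈ U, ∑ i, γ i x ^ 2 ≠ 0

/-- The Ribaucour transform `f' = f - (2 φ / A) (γ₁ N₁ + γ₂ N₂ + γ₃ N₃)`, where
`A = γ₁² + γ₂² + γ₃²`. -/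
def ribaucourTransform (f : E3 → E3) (γ : Fin 3 → E3 → ℝ) (φ : E3 → ℝ) (x : E3) : E3 :=
  f x - (2 * φ x / ∑ i, γ i x ^ 2) • ∑ i, γ i x • unitNormal f i x

/-- `g` belongs to the family of Ribaucour transforms of `f` induced by the Combescure transform
`fb` of `f`: it arises from `γᵢ = fb · Nᵢ` and some solution `φ` of `∂ᵢ φ = Hᵢ γᵢ`. -/
def IsInducedRibaucourTransform (U : Set E3) (f fb g : E3 → E3) : Prop :=
  ∃ φ : E3 → ℝ,
    IsRibaucourData U f (fun i x => inner ℝ (fb x) (unitNormal f i x)) φ ∧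
      Set.EqOn g
        (ribaucourTransform f (fun i x => inner ℝ (fb x) (unitNormal f i x)) φ) U

/-- `H₁, H₂, H₃` are, with respect to some smooth orthonormal frame `N₁, N₂, N₃`, the Lamé
coefficients of `g`: `∂ᵢ g = Hᵢ Nᵢ`. Zeros of `Hᵢ`, where `g` degenerates, are allowed. -/
def HasLameCoefficients (U : Set E3) (g : E3 → E3) (H : Fin 3 → E3 → ℝ) : Prop :=
  ∃ N : Fin 3 → E3 → E3, (∀ i, ContDiffOn ℝ ∞ (N i) U) ∧
    ∀ x ∈ U, Orthonormal ℝ (fun i => N i x) ∧ ∀ i, pd i g x = H i x • N i x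

/-- The function `φ = (H₁ H̄₁ + H₂ H̄₂ - H₃ H̄₃) / α²`. -/
def backlundPhi (α : ℝ) (f fb : E3 → E3) (x : E3) : ℝ :=
  (lame f 0 x * lameAlong f fb 0 x + lame f 1 x * lameAlong f fb 1 x
    - lame f 2 x * lameAlong f fb 2 x) / α ^ 2

/-- The map `f - (2 φ / |fb|²) fb` with `φ = (H₁ H̄₁ + H₂ H̄₂ - H₃ H̄₃) / α²`. -/
def backlund (α : ℝ) (f fb : E3 → E3) (x : E3) : E3 :=
  f x - (2 * backlundPhi α f fb x / ‖fb x‖ ^ 2) • fb x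

end

end TriplyOrthogonal

/-! A Combescure transform shares the normals `Nᵢ` of `f`, hence its rotational coefficients: `∂ᵢHⱼ
= βᵢⱼHᵢ` and `∂ᵢH̄ⱼ = βᵢⱼH̄ᵢ` for `i ≠ j` (`pd_lame`, `pd_lameAlong`). Let `⟨·,·⟩` have signature
`(+,+,-)`. Differentiating `⟨H,H⟩ = 0`, `⟨H̄,H̄⟩ = α²|f̄|²` and `⟨H,H̄⟩ = α²φ` in direction `i` and
eliminating the diagonal derivatives `∂ᵢHᵢ`, `∂ᵢH̄ᵢ` gives `∂ᵢφ = Hᵢγᵢ` (`pd_backlundPhi`).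
Solutions on a connected domain differ by constants, so the family is given by `φ + c`.

A transform has partial derivatives `(Hᵢ - tH̄ᵢ)Nᵢ'`, with `t = 2(φ + c)/|f̄|²` and `Nᵢ'` the
reflection of `Nᵢ` in the plane orthogonal to `f̄` (`pd_sub_smul`). Expanding `⟨H - tH̄, H - tH̄⟩`
leaves `4α²c(φ + c)/|f̄|²` (`norm_pd_sq_sum`). If this vanishes on an open set and `c ≠ 0`, then `φ`
is constant there, so every `γᵢ = 0` and `f̄ = 0`, which is excluded. -/

namespace TriplyOrthogonal

/-! ### Calculus of partial derivatives -/

section PartialDerivatives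

variable {F : Type*} [NormedAddCommGroup F] [NormedSpace ℝ F] {U : Set E3} {x : E3}

lemma differentiableAt_of_contDiffOn {g : E3 → F} (hU : IsOpen U)
    (hg : ContDiffOn ℝ ∞ g U) (hx : x ∈ U) : DifferentiableAt ℝ g x :=
  (hg.contDiffAt (hU.mem_nhds hx)).differentiableAt (by simp)

lemma pd_congr {g h : E3 → F} (hU : IsOpen U) (hgh : Set.EqOn g h U) (hx : x ∈ U) (i : Fin 3) :
    pd i g x = pd i h x := by
  rw [pd, pd, (hgh.eventuallyEq_of_mem (hU.mem_nhds hx)).fderiv_eq]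

lemma pd_const (c : F) (i : Fin 3) : pd i (fun _ : E3 => c) x = 0 := by
  simp [pd]

lemma pd_sub {g h : E3 → F} (hg : DifferentiableAt ℝ g x) (hh : DifferentiableAt ℝ h x)
    (i : Fin 3) : pd i (fun y => g y - h y) x = pd i g x - pd i h x := by
  simp [pd, fderiv_fun_sub hg hh]

lemma pd_add {g h : E3 → F} (hg : DifferentiableAt ℝ g x) (hh : DifferentiableAt ℝ h x)
    (i : Fin 3) : pd i (fun y => g y + h y) x = pd i g x + pd i h x := by
  simp [pd, fderiv_fun_add hg hh]

lemma pd_smul {a : E3 → ℝ} {g : E3 → F} (ha : DifferentiableAt ℝ a x)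
    (hg : DifferentiableAt ℝ g x) (i : Fin 3) :
    pd i (fun y => a y • g y) x = a x • pd i g x + pd i a x • g x := by
  simp [pd, fderiv_fun_smul ha hg]

lemma pd_mul {a b : E3 → ℝ} (ha : DifferentiableAt ℝ a x) (hb : DifferentiableAt ℝ b x)
    (i : Fin 3) : pd i (fun y => a y * b y) x = a x * pd i b x + pd i a x * b x :=
  pd_smul ha hb i

lemma pd_inner {g h : E3 → E3} (hg : DifferentiableAt ℝ g x) (hh : DifferentiableAt ℝ h x)
    (i : Fin 3) : pd i (fun y => inner ℝ (g y) (h y)) x =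
      inner ℝ (g x) (pd i h x) + inner ℝ (pd i g x) (h x) := by
  simp [pd, fderiv_inner_apply ℝ hg hh]

lemma contDiffOn_pd {g : E3 → F} (hU : IsOpen U) (hg : ContDiffOn ℝ ∞ g U) (i : Fin 3) :
    ContDiffOn ℝ ∞ (pd i g) U :=
  (hg.fderiv_of_isOpen hU (m := ∞) (by simp)).clm_apply contDiffOn_const

lemma pd_pd_comm {g : E3 → F} (hU : IsOpen U) (hg : ContDiffOn ℝ ∞ g U) (hx : x ∈ U)
    (i j : Fin 3) : pd i (pd j g) x = pd j (pd i g) x := by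
  have hd : DifferentiableAt ℝ (fderiv ℝ g) x :=
    differentiableAt_of_contDiffOn hU (hg.fderiv_of_isOpen hU (by simp)) hx
  have key : ∀ v w : E3, fderiv ℝ (fun y => fderiv ℝ g y v) x w
      = fderiv ℝ (fderiv ℝ g) x w v := by
    intro v w
    simp [fderiv_clm_apply hd (differentiableAt_const v)]
  have hs : IsSymmSndFDerivAt ℝ g x :=
    (hg.contDiffAt (hU.mem_nhds hx)).isSymmSndFDerivAt (by
      simpa using WithTop.coe_le_coe.2 (le_top : (2 : ℕ∞) ≤ ⊤))
  change fderiv ℝ (fun y => fderiv ℝ g y _) x _ = fderiv ℝ (fun y => fderiv ℝ g y _) x _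
  rw [key, key]
  exact hs.eq _ _

/-- A function with vanishing partial derivatives on a connected open set is constant. -/
lemma eq_of_pd_eq_zero {u : E3 → F} (hU : IsOpen U) (hc : IsPreconnected U)
    (hu : ContDiffOn ℝ ∞ u U) (h : ∀ x ∈ U, ∀ i, pd i u x = 0) {x y : E3} (hx : x ∈ U)
    (hy : y ∈ U) : u x = u y := by
  refine hU.is_const_of_fderiv_eq_zero hc (hu.differentiableOn (by simp)) (fun z hz => ?_) hx hy
  have : (fderiv ℝ u z : E3 →ₗ[ℝ] F) = 0 := by
    refine (EuclideanSpace.basisFun (Fin 3) ℝ).toBasis.ext fun i => ?_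
    simpa [pd] using h z hz i
  ext v
  exact congrArg (fun l : E3 →ₗ[ℝ] F => l v) this

end PartialDerivatives

/-! ### Cross products and orthonormal frames -/

section Frame

lemma inner_cross_cross (a b c d : E3) :
    inner ℝ (cross a b) (cross c d) =
      inner ℝ a c * inner ℝ b d - inner ℝ a d * inner ℝ b c := by
  simp [cross, PiLp.inner_apply, Fin.sum_univ_three, cross_apply]
  ring

lemma inner_cross_left (a b : E3) : inner ℝ a (cross a b) = 0 := by
  simp [cross, PiLp.inner_apply, Fin.sum_univ_three, cross_apply]
  ring

lemma inner_cross_right (a b : E3) : inner ℝ b (cross a b) = 0 := by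
  simp [cross, PiLp.inner_apply, Fin.sum_univ_three, cross_apply]
  ring

lemma contDiffOn_cross {U : Set E3} {g h : E3 → E3} (hg : ContDiffOn ℝ ∞ g U)
    (hh : ContDiffOn ℝ ∞ h U) : ContDiffOn ℝ ∞ (fun x => cross (g x) (h x)) U := by
  rw [contDiffOn_euclidean] at hg hh ⊢
  intro i
  fin_cases i <;> simp [cross, cross_apply] <;>
    exact ((hg _).mul (hh _)).sub ((hg _).mul (hh _))

lemma sum_inner_smul_of_orthonormal {N : Fin 3 → E3} (hN : Orthonormal ℝ N) (v : E3) :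
    ∑ i, inner ℝ v (N i) • N i = v := by
  have hs := hN.linearIndependent.span_eq_top_of_card_eq_finrank (by simp)
  have h := (OrthonormalBasis.mk hN hs.ge).sum_repr' v
  simpa [real_inner_comm] using h

end Frame

/-! ### Structure equations of a triply orthogonal system and its Combescure transforms -/

section System

variable {U : Set E3} {f g : E3 → E3} {x : E3}

namespace IsTriplyOrthogonalSystem

lemma pd_ne_zero (hf : IsTriplyOrthogonalSystem U f) (hx : x ∈ U) (i : Fin 3) :
    pd i f x ≠ 0 := by
  intro h
  exact hf.det_ne_zero x hx (Matrix.det_eq_zero_of_column_eq_zero i fun k => by simp [h])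

lemma cross_ne_zero (hf : IsTriplyOrthogonalSystem U f) (hx : x ∈ U) (i : Fin 3) :
    cross (pd (i + 1) f x) (pd (i + 2) f x) ≠ 0 := by
  have h0 := hf.orthogonal x hx (i + 1) (i + 2) (by fin_cases i <;> decide)
  rw [← inner_self_ne_zero (𝕜 := ℝ), inner_cross_cross, h0, zero_mul, sub_zero]
  exact mul_ne_zero (inner_self_ne_zero.2 (hf.pd_ne_zero hx _))
    (inner_self_ne_zero.2 (hf.pd_ne_zero hx _))

lemma orthonormal_unitNormal (hf : IsTriplyOrthogonalSystem U f) (hx : x ∈ U) :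
    Orthonormal ℝ (fun i => unitNormal f i x) := by
  refine ⟨fun i => norm_smul_inv_norm (hf.cross_ne_zero hx i), fun i j hij => ?_⟩
  have h := hf.orthogonal x hx
  simp only [unitNormal, real_inner_smul_left, real_inner_smul_right, inner_cross_cross]
  fin_cases i <;> fin_cases j <;> simp at hij ⊢ <;> simp [h]

lemma inner_pd_unitNormal (i j : Fin 3) (hij : i ≠ j) :
    inner ℝ (pd i f x) (unitNormal f j x) = 0 := by
  rw [unitNormal, real_inner_smul_right]
  have : i = j + 1 ∨ i = j + 2 := by
    fin_cases i <;> fin_cases j <;> simp at hij ⊢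
  rcases this with rfl | rfl
  · rw [inner_cross_left, mul_zero]
  · rw [inner_cross_right, mul_zero]

lemma pd_eq (hf : IsTriplyOrthogonalSystem U f) (hx : x ∈ U) (i : Fin 3) :
    pd i f x = lame f i x • unitNormal f i x := by
  conv_lhs => rw [← sum_inner_smul_of_orthonormal (hf.orthonormal_unitNormal hx) (pd i f x)]
  rw [Finset.sum_eq_single i]
  · rfl
  · intro j _ hj
    rw [inner_pd_unitNormal i j hj.symm, zero_smul]
  · simp

lemma lame_ne_zero (hf : IsTriplyOrthogonalSystem U f) (hx : x ∈ U) (i : Fin 3) :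
    lame f i x ≠ 0 := by
  intro h
  apply hf.pd_ne_zero hx i
  rw [hf.pd_eq hx, h, zero_smul]

lemma lame_sq (hf : IsTriplyOrthogonalSystem U f) (hx : x ∈ U) (i : Fin 3) :
    lame f i x ^ 2 = ‖pd i f x‖ ^ 2 := by
  rw [hf.pd_eq hx, norm_smul, (hf.orthonormal_unitNormal hx).1 i, mul_one, Real.norm_eq_abs,
    sq_abs]

lemma contDiffOn_unitNormal (hf : IsTriplyOrthogonalSystem U f) (i : Fin 3) :
    ContDiffOn ℝ ∞ (unitNormal f i) U := by
  have hc := contDiffOn_cross (contDiffOn_pd hf.isOpen hf.smooth (i + 1))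
    (contDiffOn_pd hf.isOpen hf.smooth (i + 2))
  exact ((hc.norm ℝ fun x hx => hf.cross_ne_zero hx i).inv
    fun x hx => norm_ne_zero_iff.2 (hf.cross_ne_zero hx i)).smul hc

lemma contDiffOn_lameAlong (hf : IsTriplyOrthogonalSystem U f) (hg : ContDiffOn ℝ ∞ g U)
    (i : Fin 3) : ContDiffOn ℝ ∞ (lameAlong f g i) U :=
  (contDiffOn_pd hf.isOpen hg i).inner ℝ (hf.contDiffOn_unitNormal i)

lemma contDiffOn_lame (hf : IsTriplyOrthogonalSystem U f) (i : Fin 3) :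
    ContDiffOn ℝ ∞ (lame f i) U :=
  hf.contDiffOn_lameAlong hf.smooth i

/-- The equality of mixed derivatives, expressed in the frame of unit normals. -/
lemma smul_pd_unitNormal_add (hf : IsTriplyOrthogonalSystem U f) (hg : ContDiffOn ℝ ∞ g U)
    (hfg : ∀ y ∈ U, ∀ i, pd i g y = lameAlong f g i y • unitNormal f i y) (hx : x ∈ U)
    (i j : Fin 3) :
    lameAlong f g j x • pd i (unitNormal f j) x + pd i (lameAlong f g j) x • unitNormal f j x =
      lameAlong f g i x • pd j (unitNormal f i) x
        + pd j (lameAlong f g i) x • unitNormal f i x := by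
  have hH := fun k => differentiableAt_of_contDiffOn hf.isOpen
    (hf.contDiffOn_lameAlong hg k) hx
  have hN := fun k => differentiableAt_of_contDiffOn hf.isOpen
    (hf.contDiffOn_unitNormal k) hx
  rw [← pd_smul (hH j) (hN j), ← pd_smul (hH i) (hN i),
    ← pd_congr hf.isOpen (fun y hy => hfg y hy j) hx,
    ← pd_congr hf.isOpen (fun y hy => hfg y hy i) hx]
  exact pd_pd_comm hf.isOpen hg hx i j

lemma inner_pd_unitNormal_antisymm (hf : IsTriplyOrthogonalSystem U f) (hx : x ∈ U)
    (i j k : Fin 3) :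
    inner ℝ (pd i (unitNormal f j) x) (unitNormal f k x)
      = -inner ℝ (pd i (unitNormal f k) x) (unitNormal f j x) := by
  have hN := fun k => differentiableAt_of_contDiffOn hf.isOpen
    (hf.contDiffOn_unitNormal k) hx
  have h := pd_inner (hN j) (hN k) i
  have hc : Set.EqOn (fun y => inner ℝ (unitNormal f j y) (unitNormal f k y))
      (fun _ => if j = k then (1 : ℝ) else 0) U := fun y hy =>
    orthonormal_iff_ite.1 (hf.orthonormal_unitNormal hy) j k
  rw [pd_congr hf.isOpen hc hx, pd_const, real_inner_comm] at h
  linarith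

/-- For `g` with `∂ᵢ g = Gᵢ Nᵢ`: the derivative of `Gⱼ` in terms of the connection of the
frame. -/
lemma pd_lameAlong_eq_inner (hf : IsTriplyOrthogonalSystem U f) (hg : ContDiffOn ℝ ∞ g U)
    (hfg : ∀ y ∈ U, ∀ i, pd i g y = lameAlong f g i y • unitNormal f i y) (hx : x ∈ U)
    {i j : Fin 3} (hij : i ≠ j) :
    pd i (lameAlong f g j) x =
      lameAlong f g i x * inner ℝ (pd j (unitNormal f i) x) (unitNormal f j x) := by
  have h := congrArg (fun v => inner ℝ v (unitNormal f j x))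
    (hf.smul_pd_unitNormal_add hg hfg hx i j)
  have hjj := hf.inner_pd_unitNormal_antisymm hx i j j
  have hN := orthonormal_iff_ite.1 (hf.orthonormal_unitNormal hx)
  simp only [inner_add_left, real_inner_smul_left, hN, if_neg hij, if_true] at h
  have h0 : inner ℝ (pd i (unitNormal f j) x) (unitNormal f j x) = 0 := by linarith
  rw [h0] at h
  linarith

lemma inner_pd_unitNormal_eq_rotCoeff (hf : IsTriplyOrthogonalSystem U f) (hx : x ∈ U)
    {i j : Fin 3} (hij : i ≠ j) :
    inner ℝ (pd i (unitNormal f j) x) (unitNormal f i x) = rotCoeff f j i x := by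
  have h := hf.pd_lameAlong_eq_inner hf.smooth (fun _ hy i => hf.pd_eq hy i) hx hij.symm
  have h0 : lameAlong f f j x ≠ 0 := hf.lame_ne_zero hx j
  rw [rotCoeff]
  change _ = (lameAlong f f j x)⁻¹ * pd j (lameAlong f f i) x
  rw [h, inv_mul_cancel_left₀ h0]

/-- The connection coefficients depend only on the frame, so every `g` adapted to the normals of `f`
obeys the same linear system as `f` itself. -/
lemma pd_lameAlong (hf : IsTriplyOrthogonalSystem U f) (hg : ContDiffOn ℝ ∞ g U)
    (hfg : ∀ y ∈ U, ∀ i, pd i g y = lameAlong f g i y • unitNormal f i y) (hx : x ∈ U)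
    {i j : Fin 3} (hij : i ≠ j) :
    pd i (lameAlong f g j) x = rotCoeff f i j x * lameAlong f g i x := by
  rw [hf.pd_lameAlong_eq_inner hg hfg hx hij, hf.inner_pd_unitNormal_eq_rotCoeff hx hij.symm,
    mul_comm]

lemma pd_lame (hf : IsTriplyOrthogonalSystem U f) (hx : x ∈ U) {i j : Fin 3} (hij : i ≠ j) :
    pd i (lame f j) x = rotCoeff f i j x * lame f i x :=
  hf.pd_lameAlong hf.smooth (fun _ hy i => hf.pd_eq hy i) hx hij

/-- The mechanism of Dupin's theorem: `⟨∂ₐN_b, N_c⟩` is antisymmetric in `b, c` and, weighted by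
`H_b`, symmetric under exchange of `a, b`. Going once around the three indices returns the quantity
with the opposite sign. -/
lemma inner_pd_unitNormal_eq_zero (hf : IsTriplyOrthogonalSystem U f) (hx : x ∈ U)
    {i j k : Fin 3} (hij : i ≠ j) (hik : i ≠ k) (hjk : j ≠ k) :
    inner ℝ (pd i (unitNormal f j) x) (unitNormal f k x) = 0 := by
  have hN := orthonormal_iff_ite.1 (hf.orthonormal_unitNormal hx)
  have key : ∀ a b c : Fin 3, a ≠ c → b ≠ c →
      lame f b x * inner ℝ (pd a (unitNormal f b) x) (unitNormal f c x)
        = lame f a x * inner ℝ (pd b (unitNormal f a) x) (unitNormal f c x) := by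
    intro a b c hac hbc
    have h := congrArg (fun v => inner ℝ v (unitNormal f c x))
      (hf.smul_pd_unitNormal_add hf.smooth (fun _ hy i => hf.pd_eq hy i) hx a b)
    simp only [inner_add_left, real_inner_smul_left, hN, if_neg hac, if_neg hbc, mul_zero,
      add_zero] at h
    exact h
  have h1 := key i j k hik hjk
  have h2 := key j k i hij.symm hik.symm
  have h3 := key k i j hjk.symm hij
  have a1 := hf.inner_pd_unitNormal_antisymm hx i j k
  have a2 := hf.inner_pd_unitNormal_antisymm hx j i k
  have a3 := hf.inner_pd_unitNormal_antisymm hx k i j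
  rw [a2] at h1
  rw [a3] at h3
  rw [a1] at h1 ⊢
  have hi := hf.lame_ne_zero hx i
  have hj := hf.lame_ne_zero hx j
  have hk := hf.lame_ne_zero hx k
  have : lame f j x * lame f k x * inner ℝ (pd i (unitNormal f k) x) (unitNormal f j x) = 0 := by
    linear_combination (-1 / 2 * lame f k x) * h1 + (1 / 2 * lame f i x) * h2
      - (1 / 2 * lame f j x) * h3
  simpa [hj, hk] using this

lemma pd_unitNormal (hf : IsTriplyOrthogonalSystem U f) (hx : x ∈ U) {i j : Fin 3}
    (hij : i ≠ j) : pd i (unitNormal f j) x = rotCoeff f j i x • unitNormal f i x := by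
  rw [← sum_inner_smul_of_orthonormal (hf.orthonormal_unitNormal hx) (pd i (unitNormal f j) x),
    Finset.sum_eq_single i, hf.inner_pd_unitNormal_eq_rotCoeff hx hij]
  · intro k _ hk
    rcases eq_or_ne j k with rfl | hjk
    · have := hf.inner_pd_unitNormal_antisymm hx i j j
      rw [show inner ℝ (pd i (unitNormal f j) x) (unitNormal f j x) = 0 by linarith, zero_smul]
    · rw [hf.inner_pd_unitNormal_eq_zero hx hij hk.symm hjk, zero_smul]
  · simp

end IsTriplyOrthogonalSystem

namespace IsCombescurePair

lemma pd_eq (h : IsCombescurePair U f g) (hx : x ∈ U) (i : Fin 3) :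
    pd i g x = lameAlong f g i x • unitNormal f i x := by
  obtain ⟨c, hc⟩ := h.2.2 (i + 1) i (by fin_cases i <;> decide)
  rw [lameAlong, hc x hx, h.1.pd_eq hx i, real_inner_smul_left, real_inner_smul_left,
    real_inner_self_eq_norm_sq, (h.1.orthonormal_unitNormal hx).1 i, smul_smul]
  simp

lemma lameAlong_ne_zero (h : IsCombescurePair U f g) (hx : x ∈ U) (i : Fin 3) :
    lameAlong f g i x ≠ 0 := by
  intro h0
  apply h.2.1.pd_ne_zero hx i
  rw [h.pd_eq hx, h0, zero_smul]

/-- The unit normals of `g` may be opposite to those of `f`, so the two kinds of Lamé coefficients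
agree only up to sign; squares suffice for the `χ`-condition. -/
lemma lameAlong_sq (h : IsCombescurePair U f g) (hx : x ∈ U) (i : Fin 3) :
    lameAlong f g i x ^ 2 = lame g i x ^ 2 := by
  rw [h.2.1.lame_sq hx, h.pd_eq hx, norm_smul, (h.1.orthonormal_unitNormal hx).1 i, mul_one,
    Real.norm_eq_abs, sq_abs]

lemma pd_inner_unitNormal (h : IsCombescurePair U f g) (hx : x ∈ U) {i j : Fin 3}
    (hij : i ≠ j) :
    pd i (fun y => inner ℝ (g y) (unitNormal f j y)) x =
      rotCoeff f j i x * inner ℝ (g x) (unitNormal f i x) := by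
  rw [pd_inner (differentiableAt_of_contDiffOn h.1.isOpen h.2.1.smooth hx)
    (differentiableAt_of_contDiffOn h.1.isOpen (h.1.contDiffOn_unitNormal j) hx),
    h.1.pd_unitNormal hx hij, h.pd_eq hx, real_inner_smul_left, real_inner_smul_right,
    (h.1.orthonormal_unitNormal hx).2 hij, mul_zero, add_zero]

end IsCombescurePair

lemma sum_inner_unitNormal_sq (hf : IsTriplyOrthogonalSystem U f) (hx : x ∈ U) (v : E3) :
    ∑ i, inner ℝ v (unitNormal f i x) ^ 2 = ‖v‖ ^ 2 := by
  have h := congrArg (fun w => inner ℝ v w)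
    (sum_inner_smul_of_orthonormal (hf.orthonormal_unitNormal hx) v)
  simp only [inner_sum, real_inner_smul_right, real_inner_self_eq_norm_sq] at h
  rw [← h]
  exact Finset.sum_congr rfl fun i _ => sq _

lemma ribaucourTransform_eq (hf : IsTriplyOrthogonalSystem U f) (hx : x ∈ U) (g : E3 → E3)
    (φ : E3 → ℝ) :
    ribaucourTransform f (fun i y => inner ℝ (g y) (unitNormal f i y)) φ x =
      f x - (2 * φ x / ‖g x‖ ^ 2) • g x := by
  rw [ribaucourTransform, sum_inner_unitNormal_sq hf hx,
    sum_inner_smul_of_orthonormal (hf.orthonormal_unitNormal hx)]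

end System

end TriplyOrthogonal

namespace TriplyOrthogonal

variable {U : Set E3} {f fb : E3 → E3} {φ : E3 → ℝ} {x : E3} {α : ℝ}

/-! ### Ribaucour transforms induced by a Combescure transform -/

section Ribaucour

/-- The partial derivatives of a Ribaucour transform are multiples of the reflected normals. -/
lemma IsCombescurePair.pd_sub_smul (h : IsCombescurePair U f fb) (hne : ∀ x ∈ U, fb x ≠ 0)
    (hφ : ContDiffOn ℝ ∞ φ U)
    (hpd : ∀ x ∈ U, ∀ i, pd i φ x = lame f i x * inner ℝ (fb x) (unitNormal f i x))
    (hx : x ∈ U) (i : Fin 3) :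
    pd i (fun y => f y - (2 * φ y / ‖fb y‖ ^ 2) • fb y) x =
      (lame f i x - 2 * φ x / ‖fb x‖ ^ 2 * lameAlong f fb i x) •
        (unitNormal f i x
          - (2 * inner ℝ (fb x) (unitNormal f i x) / ‖fb x‖ ^ 2) • fb x) := by
  have hU := h.1.isOpen
  have hA : ∀ y ∈ U, ‖fb y‖ ^ 2 ≠ 0 := fun y hy => pow_ne_zero 2 (norm_ne_zero_iff.2 (hne y hy))
  have dfb := differentiableAt_of_contDiffOn hU h.2.1.smooth hx
  have dA : DifferentiableAt ℝ (fun y => ‖fb y‖ ^ 2) x := dfb.norm_sq ℝ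
  have dφ := differentiableAt_of_contDiffOn hU hφ hx
  have dq : DifferentiableAt ℝ (fun y => 2 * φ y / ‖fb y‖ ^ 2) x := by
    simpa only [div_eq_mul_inv] using (dφ.const_mul 2).fun_mul (dA.fun_inv (hA x hx))
  have hpA : pd i (fun y => ‖fb y‖ ^ 2) x =
      2 * (lameAlong f fb i x * inner ℝ (fb x) (unitNormal f i x)) := by
    simp only [← real_inner_self_eq_norm_sq]
    rw [pd_inner dfb dfb, h.pd_eq hx, real_inner_smul_left, real_inner_smul_right,
      real_inner_comm]
    ring
  -- With `q = 2φ/|f̄|²`, differentiating `q|f̄|² = 2φ` replaces the quotient rule. It yields `∂ᵢq =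
  -- (2γᵢ/|f̄|²)(Hᵢ - qH̄ᵢ)`, so `Hᵢ - qH̄ᵢ` factors out of the whole derivative.
  have hq : pd i (fun y => 2 * φ y / ‖fb y‖ ^ 2) x * ‖fb x‖ ^ 2 =
      2 * pd i φ x - 2 * φ x / ‖fb x‖ ^ 2 * pd i (fun y => ‖fb y‖ ^ 2) x := by
    have h1 := pd_mul dq dA i
    have h2 : Set.EqOn (fun y => 2 * φ y / ‖fb y‖ ^ 2 * ‖fb y‖ ^ 2) (fun y => 2 * φ y) U :=
      fun y hy => div_mul_cancel₀ _ (hA y hy)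
    rw [pd_congr hU h2 hx, pd_mul (differentiableAt_const 2) dφ, pd_const] at h1
    linarith
  rw [pd_sub (differentiableAt_of_contDiffOn hU h.1.smooth hx) (dq.fun_smul dfb),
    pd_smul dq dfb, h.1.pd_eq hx, h.pd_eq hx, eq_div_of_mul_eq (hA x hx) hq, hpA, hpd x hx]
  have := hA x hx
  match_scalars <;> field_simp

/-- The vectors are the images of the frame under reflection in the plane orthogonal to `v`, an
isometry. -/
lemma orthonormal_reflection {N : Fin 3 → E3} (hN : Orthonormal ℝ N) {v : E3} (hv : v ≠ 0) :
    Orthonormal ℝ (fun i => N i - (2 * inner ℝ v (N i) / ‖v‖ ^ 2) • v) := by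
  rw [orthonormal_iff_ite] at hN ⊢
  intro i j
  have hA : ‖v‖ ^ 2 ≠ 0 := pow_ne_zero 2 (norm_ne_zero_iff.2 hv)
  rw [← hN i j]
  simp only [inner_sub_left, inner_sub_right, real_inner_smul_left, real_inner_smul_right,
    real_inner_self_eq_norm_sq, real_inner_comm v]
  field_simp
  ring

lemma IsCombescurePair.isRibaucourData (h : IsCombescurePair U f fb)
    (hne : ∀ x ∈ U, fb x ≠ 0) (hφ : ContDiffOn ℝ ∞ φ U)
    (hpd : ∀ x ∈ U, ∀ i, pd i φ x = lame f i x * inner ℝ (fb x) (unitNormal f i x)) :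
    IsRibaucourData U f (fun i x => inner ℝ (fb x) (unitNormal f i x)) φ where
  smooth_gamma i := h.2.1.smooth.inner ℝ (h.1.contDiffOn_unitNormal i)
  smooth_phi := hφ
  pd_gamma _ hx _ _ hij := h.pd_inner_unitNormal hx hij
  pd_phi := hpd
  gamma_ne_zero x hx := by
    rw [sum_inner_unitNormal_sq h.1 hx]
    exact pow_ne_zero 2 (norm_ne_zero_iff.2 (hne x hx))

end Ribaucour

/-! ### The potential `φ` and the uniqueness of the Guichard net -/

section Backlund

lemma contDiffOn_backlundPhi (h : IsCombescurePair U f fb) :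
    ContDiffOn ℝ ∞ (backlundPhi α f fb) U := by
  have hH := h.1.contDiffOn_lame
  have hG := h.1.contDiffOn_lameAlong h.2.1.smooth
  exact ((((hH 0).mul (hG 0)).add ((hH 1).mul (hG 1))).sub ((hH 2).mul (hG 2))).div_const _

lemma lameAlong_sq_sum (hfb : IsChiSystem U fb (fun x => α ^ 2 * ‖fb x‖ ^ 2))
    (h : IsCombescurePair U f fb) (hx : x ∈ U) :
    lameAlong f fb 0 x ^ 2 + lameAlong f fb 1 x ^ 2 - lameAlong f fb 2 x ^ 2 =
      α ^ 2 * ‖fb x‖ ^ 2 := by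
  simp only [h.lameAlong_sq hx]
  exact hfb.2 x hx

lemma pd_quadratic {p q r u v w : E3 → ℝ} (hp : DifferentiableAt ℝ p x)
    (hq : DifferentiableAt ℝ q x) (hr : DifferentiableAt ℝ r x) (hu : DifferentiableAt ℝ u x)
    (hv : DifferentiableAt ℝ v x) (hw : DifferentiableAt ℝ w x) (i : Fin 3) :
    pd i (fun y => p y * u y + q y * v y - r y * w y) x =
      p x * pd i u x + pd i p x * u x + (q x * pd i v x + pd i q x * v x)
        - (r x * pd i w x + pd i r x * w x) := by
  rw [pd_sub ((hp.fun_mul hu).fun_add (hq.fun_mul hv)) (hr.fun_mul hw),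
    pd_add (hp.fun_mul hu) (hq.fun_mul hv),
    pd_mul hp hu, pd_mul hq hv, pd_mul hr hw]

/-- The function `φ` integrates `∂ᵢ φ = Hᵢ γᵢ`. -/
lemma pd_backlundPhi (hα : α ≠ 0) (hf : IsGuichardNet U f)
    (hfb : IsChiSystem U fb (fun x => α ^ 2 * ‖fb x‖ ^ 2)) (h : IsCombescurePair U f fb)
    (hx : x ∈ U) (i : Fin 3) :
    pd i (backlundPhi α f fb) x = lame f i x * inner ℝ (fb x) (unitNormal f i x) := by
  have hU := h.1.isOpen
  have dH := fun k => differentiableAt_of_contDiffOn hU (h.1.contDiffOn_lame k) hx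
  have dG := fun k => differentiableAt_of_contDiffOn hU
    (h.1.contDiffOn_lameAlong h.2.1.smooth k) hx
  have dfb := differentiableAt_of_contDiffOn hU h.2.1.smooth hx
  have dφ := differentiableAt_of_contDiffOn hU (contDiffOn_backlundPhi (α := α) h) hx
  have e1 : Set.EqOn
      (fun y => lame f 0 y * lame f 0 y + lame f 1 y * lame f 1 y - lame f 2 y * lame f 2 y)
      (fun _ => (0 : ℝ)) U := fun y hy => by
    have := hf.2 y hy
    simp only at this ⊢
    linarith
  have e2 : Set.EqOn
      (fun y => lameAlong f fb 0 y * lameAlong f fb 0 y + lameAlong f fb 1 y * lameAlong f fb 1 y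
        - lameAlong f fb 2 y * lameAlong f fb 2 y)
      (fun y => α ^ 2 * inner ℝ (fb y) (fb y)) U := fun y hy => by
    have := lameAlong_sq_sum hfb h hy
    simp only [real_inner_self_eq_norm_sq]
    linarith
  have e3 : Set.EqOn
      (fun y => lame f 0 y * lameAlong f fb 0 y + lame f 1 y * lameAlong f fb 1 y
        - lame f 2 y * lameAlong f fb 2 y)
      (fun y => α ^ 2 * backlundPhi α f fb y) U := fun y _ => by
    simp only [backlundPhi]
    field_simp
  have d1 := pd_quadratic (dH 0) (dH 1) (dH 2) (dH 0) (dH 1) (dH 2) i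
  have d2 := pd_quadratic (dG 0) (dG 1) (dG 2) (dG 0) (dG 1) (dG 2) i
  have d3 := pd_quadratic (dH 0) (dH 1) (dH 2) (dG 0) (dG 1) (dG 2) i
  rw [pd_congr hU e1 hx, pd_const] at d1
  rw [pd_congr hU e2 hx, pd_mul (differentiableAt_const _) (dfb.inner ℝ dfb), pd_const,
    pd_inner dfb dfb, h.pd_eq hx, real_inner_smul_left, real_inner_smul_right,
    real_inner_comm (fb x)] at d2
  rw [pd_congr hU e3 hx, pd_mul (differentiableAt_const _) dφ, pd_const] at d3
  have hH := h.1.lame_ne_zero hx i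
  have hG := h.lameAlong_ne_zero hx i
  have pH := fun j (hij : i ≠ j) => h.1.pd_lame hx hij
  have pG := fun j (hij : i ≠ j) => h.1.pd_lameAlong h.2.1.smooth (fun _ hy => h.pd_eq hy) hx hij
  -- After multiplication by `HᵢH̄ᵢ`, the derivative of `⟨H,H̄⟩` is `H̄ᵢ²/2` times that of `⟨H,H⟩`
  -- plus `Hᵢ²/2` times that of `⟨H̄,H̄⟩`: the diagonal derivatives and all `βᵢⱼ` cancel.
  refine mul_left_cancel₀ (mul_ne_zero (mul_ne_zero (pow_ne_zero 2 hα) hH) hG) ?_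
  fin_cases i
  · simp only [Fin.zero_eta] at *
    rw [pH 1 (by decide), pH 2 (by decide)] at d1 d3
    rw [pG 1 (by decide), pG 2 (by decide)] at d2 d3
    linear_combination lame f 0 x * lameAlong f fb 0 x * d3
      - lameAlong f fb 0 x ^ 2 / 2 * d1 - lame f 0 x ^ 2 / 2 * d2
  · simp only [Fin.mk_one] at *
    rw [pH 0 (by decide), pH 2 (by decide)] at d1 d3
    rw [pG 0 (by decide), pG 2 (by decide)] at d2 d3
    linear_combination lame f 1 x * lameAlong f fb 1 x * d3
      - lameAlong f fb 1 x ^ 2 / 2 * d1 - lame f 1 x ^ 2 / 2 * d2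
  · simp only [Fin.reduceFinMk] at *
    rw [pH 0 (by decide), pH 1 (by decide)] at d1 d3
    rw [pG 0 (by decide), pG 1 (by decide)] at d2 d3
    linear_combination lame f 2 x * lameAlong f fb 2 x * d3
      - lameAlong f fb 2 x ^ 2 / 2 * d1 - lame f 2 x ^ 2 / 2 * d2

lemma pd_backlundPhi_add (hα : α ≠ 0) (hf : IsGuichardNet U f)
    (hfb : IsChiSystem U fb (fun x => α ^ 2 * ‖fb x‖ ^ 2)) (h : IsCombescurePair U f fb)
    (c : ℝ) (hx : x ∈ U) (i : Fin 3) :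
    pd i (fun y => backlundPhi α f fb y + c) x =
      lame f i x * inner ℝ (fb x) (unitNormal f i x) := by
  rw [pd_add (differentiableAt_of_contDiffOn h.1.isOpen (contDiffOn_backlundPhi h) hx)
    (differentiableAt_const c), pd_const, add_zero, pd_backlundPhi hα hf hfb h hx]

lemma isInducedRibaucourTransform_iff (hα : α ≠ 0) (hf : IsGuichardNet U f)
    (hfb : IsChiSystem U fb (fun x => α ^ 2 * ‖fb x‖ ^ 2)) (h : IsCombescurePair U f fb)
    (hne : ∀ x ∈ U, fb x ≠ 0) (g : E3 → E3) :
    IsInducedRibaucourTransform U f fb g ↔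
      ∃ c : ℝ, ∀ x ∈ U, g x = f x - (2 * (backlundPhi α f fb x + c) / ‖fb x‖ ^ 2) • fb x := by
  have hU := h.1.isOpen
  constructor
  · rintro ⟨ψ, hψ, hg⟩
    obtain ⟨x₀, hx₀⟩ := h.1.isConnected.nonempty
    -- Both potentials have the same partial derivatives, so their difference is its value at any
    -- base point.
    refine ⟨ψ x₀ - backlundPhi α f fb x₀, fun x hx => ?_⟩
    have hs := contDiffOn_backlundPhi (α := α) h
    have hc := eq_of_pd_eq_zero hU h.1.isConnected.isPreconnected (hψ.smooth_phi.sub hs)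
      (fun y hy i => by
        change pd i (fun z => ψ z - backlundPhi α f fb z) y = 0
        rw [pd_sub (differentiableAt_of_contDiffOn hU hψ.smooth_phi hy)
          (differentiableAt_of_contDiffOn hU hs hy), hψ.pd_phi y hy,
          pd_backlundPhi hα hf hfb h hy, sub_self]) hx hx₀
    rw [hg hx, ribaucourTransform_eq h.1 hx, ← hc]
    simp
  · rintro ⟨c, hc⟩
    refine ⟨fun y => backlundPhi α f fb y + c, h.isRibaucourData hne
      ((contDiffOn_backlundPhi h).add contDiffOn_const)
      (fun x hx i => pd_backlundPhi_add hα hf hfb h c hx i), fun x hx => ?_⟩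
    rw [hc x hx, ribaucourTransform_eq h.1 hx]

/-- The reflected normals serve as frame; they stay smooth and orthonormal even where a coefficient
vanishes and the map degenerates. -/
lemma hasLameCoefficients_backlund (hα : α ≠ 0) (hf : IsGuichardNet U f)
    (hfb : IsChiSystem U fb (fun x => α ^ 2 * ‖fb x‖ ^ 2)) (h : IsCombescurePair U f fb)
    (hne : ∀ x ∈ U, fb x ≠ 0) :
    HasLameCoefficients U (backlund α f fb) (fun i x => lame f i x
      - 2 * backlundPhi α f fb x / ‖fb x‖ ^ 2 * lameAlong f fb i x) := by
  refine ⟨fun i x => unitNormal f i x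
    - (2 * inner ℝ (fb x) (unitNormal f i x) / ‖fb x‖ ^ 2) • fb x, fun i => ?_, fun x hx =>
    ⟨orthonormal_reflection (h.1.orthonormal_unitNormal hx) (hne x hx), fun i =>
      h.pd_sub_smul hne (contDiffOn_backlundPhi h)
        (fun y hy i => pd_backlundPhi hα hf hfb h hy i) hx i⟩⟩
  have hN := h.1.contDiffOn_unitNormal i
  have hb := h.2.1.smooth
  exact hN.sub (((contDiffOn_const.mul (hb.inner ℝ hN)).div (hb.norm_sq ℝ)
    fun x hx => pow_ne_zero 2 (norm_ne_zero_iff.2 (hne x hx))).smul hb)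

/-- The trace of the induced metric of the transform with potential `φ + c`. -/
lemma norm_pd_sq_sum (hα : α ≠ 0) (hf : IsGuichardNet U f)
    (hfb : IsChiSystem U fb (fun x => α ^ 2 * ‖fb x‖ ^ 2)) (h : IsCombescurePair U f fb)
    (hne : ∀ x ∈ U, fb x ≠ 0) {g : E3 → E3} {c : ℝ}
    (hg : ∀ x ∈ U, g x = f x - (2 * (backlundPhi α f fb x + c) / ‖fb x‖ ^ 2) • fb x)
    (hx : x ∈ U) :
    ‖pd 0 g x‖ ^ 2 + ‖pd 1 g x‖ ^ 2 - ‖pd 2 g x‖ ^ 2 =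
      4 * α ^ 2 / ‖fb x‖ ^ 2 * (c * (backlundPhi α f fb x + c)) := by
  have hA : ‖fb x‖ ^ 2 ≠ 0 := pow_ne_zero 2 (norm_ne_zero_iff.2 (hne x hx))
  have key : ∀ i, ‖pd i g x‖ ^ 2 = (lame f i x
      - 2 * (backlundPhi α f fb x + c) / ‖fb x‖ ^ 2 * lameAlong f fb i x) ^ 2 := by
    intro i
    rw [pd_congr h.1.isOpen hg hx, h.pd_sub_smul hne
      ((contDiffOn_backlundPhi h).add contDiffOn_const)
      (fun y hy i => pd_backlundPhi_add hα hf hfb h c hy i) hx i, norm_smul,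
      (orthonormal_reflection (h.1.orthonormal_unitNormal hx) (hne x hx)).1 i, mul_one,
      Real.norm_eq_abs, sq_abs]
  have h1 := hf.2 x hx
  have h2 := lameAlong_sq_sum hfb h hx
  have h3 : lame f 0 x * lameAlong f fb 0 x + lame f 1 x * lameAlong f fb 1 x
      - lame f 2 x * lameAlong f fb 2 x = α ^ 2 * backlundPhi α f fb x := by
    rw [backlundPhi]
    field_simp
  rw [key, key, key]
  set t := 2 * (backlundPhi α f fb x + c) / ‖fb x‖ ^ 2 with ht
  have ht' : t * ‖fb x‖ ^ 2 = 2 * (backlundPhi α f fb x + c) := div_mul_cancel₀ _ hA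
  have h4 : 4 * α ^ 2 / ‖fb x‖ ^ 2 * (c * (backlundPhi α f fb x + c)) = 2 * α ^ 2 * c * t := by
    rw [ht]
    field_simp
    ring
  rw [h4]
  -- `⟨H - tH̄, H - tH̄⟩ = -2tα²φ + t²α²|f̄|²`, and `t|f̄|² = 2(φ + c)` turns this into `2α²ct`.
  linear_combination h1 + t ^ 2 * h2 - 2 * t * h3 + t * α ^ 2 * ht'

lemma trace_eq_zero_iff_eqOn_backlund (hα : α ≠ 0) (hf : IsGuichardNet U f)
    (hfb : IsChiSystem U fb (fun x => α ^ 2 * ‖fb x‖ ^ 2)) (h : IsCombescurePair U f fb)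
    (hne : ∀ x ∈ U, fb x ≠ 0) {g : E3 → E3} (hg : IsInducedRibaucourTransform U f fb g)
    {V : Set E3} (hVU : V ⊆ U) (hV : IsOpen V) (hVne : V.Nonempty) :
    (∀ x ∈ V, ‖pd 0 g x‖ ^ 2 + ‖pd 1 g x‖ ^ 2 - ‖pd 2 g x‖ ^ 2 = 0) ↔
      Set.EqOn g (backlund α f fb) U := by
  have hA : ∀ y ∈ U, ‖fb y‖ ^ 2 ≠ 0 := fun y hy => pow_ne_zero 2 (norm_ne_zero_iff.2 (hne y hy))
  obtain ⟨c, hc⟩ := (isInducedRibaucourTransform_iff hα hf hfb h hne g).1 hg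
  constructor
  · intro hz
    have hc0 : c = 0 := by
      by_contra hc0
      -- Openness of `V` is essential: vanishing of `φ + c` on `V` passes to its derivatives `Hᵢγᵢ`,
      -- and `Hᵢ ≠ 0` then forces `|f̄|² = ∑ γᵢ² = 0`.
      have hφ : Set.EqOn (fun y => backlundPhi α f fb y + c) (fun _ => 0) V := by
        intro y hy
        have h1 := hz y hy
        rw [norm_pd_sq_sum hα hf hfb h hne hc (hVU hy)] at h1
        have h2 : 4 * α ^ 2 / ‖fb y‖ ^ 2 ≠ 0 :=
          div_ne_zero (mul_ne_zero four_ne_zero (pow_ne_zero 2 hα)) (hA y (hVU hy))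
        exact ((mul_eq_zero.1 h1).resolve_left h2 |> mul_eq_zero.1).resolve_left hc0
      obtain ⟨y, hy⟩ := hVne
      refine hA y (hVU hy) ?_
      rw [← sum_inner_unitNormal_sq h.1 (hVU hy)]
      refine Finset.sum_eq_zero fun i _ => ?_
      have h3 := pd_backlundPhi_add hα hf hfb h c (hVU hy) i
      rw [pd_congr hV hφ hy, pd_const] at h3
      rw [(mul_eq_zero.1 h3.symm).resolve_left (h.1.lame_ne_zero (hVU hy) i), sq, mul_zero]
    intro x hx
    rw [hc x hx, hc0, add_zero, backlund]
  · intro hgR x hx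
    -- One point determines `c`, because `f̄` does not vanish there.
    have hc0 : c = 0 := by
      have h1 := (hc x (hVU hx)).symm.trans (hgR (hVU hx))
      rw [backlund, sub_right_inj] at h1
      have h2 := smul_left_injective ℝ (hne x (hVU hx)) h1
      have h3 := (div_left_inj' (hA x (hVU hx))).1 h2
      linarith
    rw [norm_pd_sq_sum hα hf hfb h hne hc (hVU hx), hc0, zero_mul, mul_zero]

lemma IsTriplyOrthogonalSystem.isGuichardNet_iff {V : Set E3} {g : E3 → E3}
    (hg : IsTriplyOrthogonalSystem V g) :
    IsGuichardNet V g ↔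
      ∀ x ∈ V, ‖pd 0 g x‖ ^ 2 + ‖pd 1 g x‖ ^ 2 - ‖pd 2 g x‖ ^ 2 = 0 := by
  refine (and_iff_right hg).trans (forall₂_congr fun x hx => ?_)
  rw [hg.lame_sq hx, hg.lame_sq hx, hg.lame_sq hx]

end Backlund

end TriplyOrthogonal

theorem mainTheorem3 (U : Set E3) (f fb : E3 → E3) (α : ℝ) (hα : α ≠ 0)
    (hf : TriplyOrthogonal.IsGuichardNet U f)
    (hfb : TriplyOrthogonal.IsChiSystem U fb (fun x => α ^ 2 * ‖fb x‖ ^ 2))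
    (hcomb : TriplyOrthogonal.IsCombescurePair U f fb)
    (hne : ∀ x ∈ U, fb x ≠ 0) :
    -- the induced Ribaucour transforms form the 1-parameter family given by `φ + c`
    (∀ g : E3 → E3, TriplyOrthogonal.IsInducedRibaucourTransform U f fb g ↔
      ∃ c : ℝ, ∀ x ∈ U, g x =
        f x - (2 * (TriplyOrthogonal.backlundPhi α f fb x + c) / ‖fb x‖ ^ 2) • fb x) ∧
    -- `R(f)` belongs to this family
    TriplyOrthogonal.IsInducedRibaucourTransform U f fb (TriplyOrthogonal.backlund α f fb) ∧
    -- its Lamé coefficients are `R(Hᵢ)`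
    TriplyOrthogonal.HasLameCoefficients U (TriplyOrthogonal.backlund α f fb)
      (fun i x => TriplyOrthogonal.lame f i x
        - 2 * TriplyOrthogonal.backlundPhi α f fb x / ‖fb x‖ ^ 2
          * TriplyOrthogonal.lameAlong f fb i x) ∧
    -- a member of the family is a Guichard net, on a domain where it is a triply orthogonal
    -- system at all, exactly if it is `R(f)`
    (∀ g : E3 → E3, TriplyOrthogonal.IsInducedRibaucourTransform U f fb g →
      ∀ V : Set E3, V ⊆ U → TriplyOrthogonal.IsTriplyOrthogonalSystem V g →
        (TriplyOrthogonal.IsGuichardNet V g ↔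
          Set.EqOn g (TriplyOrthogonal.backlund α f fb) U)) ∧
    -- the same for the trace condition on the induced metric alone, without nondegeneracy
    (∀ g : E3 → E3, TriplyOrthogonal.IsInducedRibaucourTransform U f fb g →
      ∀ V : Set E3, V ⊆ U → IsOpen V → V.Nonempty →
        ((∀ x ∈ V, ‖TriplyOrthogonal.pd 0 g x‖ ^ 2 + ‖TriplyOrthogonal.pd 1 g x‖ ^ 2
            - ‖TriplyOrthogonal.pd 2 g x‖ ^ 2 = 0) ↔
          Set.EqOn g (TriplyOrthogonal.backlund α f fb) U)) := by
  refine ⟨TriplyOrthogonal.isInducedRibaucourTransform_iff hα hf hfb hcomb hne, ?_,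
    TriplyOrthogonal.hasLameCoefficients_backlund hα hf hfb hcomb hne, ?_, ?_⟩
  · refine (TriplyOrthogonal.isInducedRibaucourTransform_iff hα hf hfb hcomb hne _).2
      ⟨0, fun x _ => ?_⟩
    rw [add_zero, TriplyOrthogonal.backlund]
  · intro g hg V hVU hV
    rw [hV.isGuichardNet_iff]
    exact TriplyOrthogonal.trace_eq_zero_iff_eqOn_backlund hα hf hfb hcomb hne hg hVU hV.isOpen
      hV.isConnected.nonempty
  · intro g hg V hVU hV hVne
    exact TriplyOrthogonal.trace_eq_zero_iff_eqOn_backlund hα hf hfb hcomb hne hg hVU hV hVne
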